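/- A partition is a finite weakly decreasing sequence $\lambda=(\lambda_1\ge\dots\ge\lambda_\ell)$ of positive integers (possibly empty); write $\ell(\lambda)=\ell$, $|\lambda|=\lambda_1+\dots+\lambda_\ell$, and let $m_i(\lambda)$ be the number of parts equal to $i$. A finite sequence matches a nonempty finite sequence $v$ if $v$ occurs in it as a block of consecutive entries. Let $\mathcal{N}$ be the set of partitions $\lambda$ such that (N1) $\lambda_i-\lambda_{i+1}\ne 1$ for $1\le i\le\ell(\lambda)-1$; and, for $1\le i\le\ell(\lambda)-2$, (N2) $\lambda_i-\lambda_{i+2}\ge 3$; (N3) $\lambda_i-\lambda_{i+2}=3$ implies $\lambda_i\ne\lambda_{i+1}$; (N4) $\lambda_i-\lambda_{i+2}=3$ and $2\nmid\lambda_i$ imply $\lambda_{i+1}\ne\lambda_{i+2}$; (N5) $\lambda_i-\lambda_{i+2}=4$ and $2\nmid\lambda_i$ imply $\lambda_i\ne\lambda_{i+1}$ and $\lambda_{i+1}\ne\lambda_{i+2}$; (N6) the sequence $(\lambda_1-\lambda_2,\lambda_2-\lambda_3,\dots,\lambda_{\ell(\lambda)-1}-\lambda_{\ell(\lambda)})$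 does not match $(3,\underbrace{2,\dots,2}_{k},3,0)$ for any $k\ge0$. Put $$\mathcal{N}_1=\{\lambda\in\mathcal{N}\mid m_1(\lambda)=0\},\qquad \mathcal{N}_2=\{\lambda\in\mathcal{N}\mid m_i(\lambda)\le1\text{ for }i=1,2,3\},$$ and let $\mathcal{N}_3$ be the set of $\lambda\in\mathcal{N}$ with $m_1(\lambda)=m_3(\lambda)=0$, $m_2(\lambda)\le1$ that do not match $(2k+3,2k,2k-2,\dots,4,2)$ for any $k\ge1$. For a set $\mathcal{C}$ of partitions let $f_{\mathcal{C}}(x,q)=\sum_{\lambda\in\mathcal{C}}x^{\ell(\lambda)}q^{|\lambda|}$, a formal power series in $x$ and $q$. Then, for $a=1,2,3$, $$0=\sum_{i=0}^{5}p^{(a)}_{2i}(x,q)\,f_{\mathcal{N}_a}(xq^{2i},q),$$ where $p^{(a)}_0=1$ for $a=1,2,3$, and for $a=1$: $$\begin{aligned} p^{(1)}_2&=-1-x(q^2+q^3+q^4), & p^{(1)}_4&=xq^4(1-x+xq^3+xq^4+xq^5),\\ p^{(1)}_6&=x^2q^6\bigl(-1+xq^4(1+q+q^2-q^5)\bigr),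 & p^{(1)}_8&=x^3q^{13}(1+q+q^2)(1-xq^6),\\ p^{(1)}_{10}&=x^3q^{17}(1-xq^6)(1-xq^8); \end{aligned}$$ for $a=2$: $$\begin{aligned} p^{(2)}_2&=-1-x(q+q^2+q^4), & p^{(2)}_4&=xq^4(1+xq+xq^3),\\ p^{(2)}_6&=x^2q^{10}(-1+xq^4+xq^6), & p^{(2)}_8&=x^3q^{15}(1+q^2+q^3)(1-xq^6),\\ p^{(2)}_{10}&=x^3q^{19}(1-xq^6)(1-xq^8); \end{aligned}$$ for $a=3$: $$\begin{aligned} p^{(3)}_2&=-1-x(q^2+q^4+q^5), & p^{(3)}_4&=xq^4(1+xq^5+xq^7),\\ p^{(3)}_6&=x^2q^{10}(-1+xq^4+xq^6), & p^{(3)}_8&=x^3q^{18}(1+q+q^3)(1-xq^6),\\ p^{(3)}_{10}&=x^3q^{23}(1-xq^6)(1-xq^8). \end{aligned}$$ -/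

import Mathlib

namespace Nandi

/-- The set of all partitions: weakly decreasing finite sequences of positive integers.
The part `λ_i` (`i ≥ 1`) of a partition `l` is `l[i - 1]`, `ℓ(λ)` is `l.length`, `|λ|` is `l.sum`,
and `m_i(λ)` is `l.count i`. -/
def Par : Set (List ℕ) := {l | l.Pairwise (· ≥ ·) ∧ ∀ i ∈ l, 0 < i}

/-- The sequence of differences `(λ₁ - λ₂, λ₂ - λ₃, …)`. On partitions, which are weakly decreasing,
the truncated subtraction of natural numbers is the usual one (here and below). -/
def diffs (l : List ℕ) : List ℕ := List.zipWith (· - ·) l l.tail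

/-- The set `𝒩`; `v <:+: w` says that the sequence `w` matches `v`, that is, `v` occurs in `w`
as a block of consecutive entries. -/
structure IsNandi (l : List ℕ) : Prop where
  mem_par : l ∈ Par
  cond1 : ∀ i (_ : i + 1 < l.length), l[i] - l[i + 1] ≠ 1
  cond2 : ∀ i (_ : i + 2 < l.length), 3 ≤ l[i] - l[i + 2]
  cond3 : ∀ i (_ : i + 2 < l.length), l[i] - l[i + 2] = 3 → l[i] ≠ l[i + 1]
  cond4 : ∀ i (_ : i + 2 < l.length), l[i] - l[i + 2] = 3 → ¬ 2 ∣ l[i] → l[i + 1] ≠ l[i + 2]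
  cond5 : ∀ i (_ : i + 2 < l.length), l[i] - l[i + 2] = 4 → ¬ 2 ∣ l[i] →
    l[i] ≠ l[i + 1] ∧ l[i + 1] ≠ l[i + 2]
  cond6 : ∀ k : ℕ, ¬ ([3] ++ List.replicate k 2 ++ [3, 0]) <:+: diffs l

/-- `𝒩₁` -/
def N₁ : Set (List ℕ) := {l | IsNandi l ∧ l.count 1 = 0}

/-- `𝒩₂` -/
def N₂ : Set (List ℕ) := {l | IsNandi l ∧ l.count 1 ≤ 1 ∧ l.count 2 ≤ 1 ∧ l.count 3 ≤ 1}

/-- The sequence `(2k+3, 2k, 2k-2, …, 4, 2)`. -/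
def staircase (k : ℕ) : List ℕ := (2 * k + 3) :: (List.range k).map (fun j => 2 * (k - j))

/-- `𝒩₃` -/
def N₃ : Set (List ℕ) :=
  {l | IsNandi l ∧ l.count 1 = 0 ∧ l.count 3 = 0 ∧ l.count 2 ≤ 1 ∧
    ∀ k : ℕ, 1 ≤ k → ¬ staircase k <:+: l}

/-- The elements of `C` with `m` parts and with sum `n`. -/
def level (C : Set (List ℕ)) (m n : ℕ) : Set (List ℕ) := {l ∈ C | l.length = m ∧ l.sum = n}

theorem level_finite (C : Set (List ℕ)) (m n : ℕ) : (level C m n).Finite := by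
  refine (List.finite_length_eq (Fin (n + 1)) m |>.image (List.map Fin.val)).subset ?_
  rintro l ⟨-, hm, hn⟩
  have h : ∀ a ∈ l, a < n + 1 := fun a ha => by
    have := List.le_sum_of_mem ha
    omega
  refine ⟨l.pmap (fun a ha => (⟨a, ha⟩ : Fin (n + 1))) h, by simpa using hm, ?_⟩
  simp [List.map_pmap]

open PowerSeries in
/-- The generating function `f_C(x, q) = ∑_{λ ∈ C} x^{ℓ(λ)} q^{|λ|}` in `ℤ⟦q⟧⟦x⟧`: the coefficient
of `x^m q^n` is the number of `λ ∈ C` with `ℓ(λ) = m` and `|λ| = n` (a finite number). -/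
noncomputable def genFun (C : Set (List ℕ)) : ℤ⟦X⟧⟦X⟧ :=
  PowerSeries.mk fun m => PowerSeries.mk fun n => ((level C m n).ncard : ℤ)

open PowerSeries in
/-- The variable `x` of `ℤ⟦q⟧⟦x⟧`. -/
noncomputable def x : ℤ⟦X⟧⟦X⟧ := PowerSeries.X

open PowerSeries in
/-- The variable `q` of `ℤ⟦q⟧⟦x⟧`. -/
noncomputable def q : ℤ⟦X⟧⟦X⟧ := PowerSeries.C PowerSeries.X

open PowerSeries in
/-- The series `f(x q^k, q)` for `f = f(x, q)`. -/
noncomputable def qShift (k : ℕ) (f : ℤ⟦X⟧⟦X⟧) : ℤ⟦X⟧⟦X⟧ :=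
  PowerSeries.rescale (PowerSeries.X ^ k) f

/-- The polynomials `p_{2i}(x, q)`, `i = 0, …, 5`, for `𝒩₁`. -/
def p₁ {R : Type*} [CommRing R] (x q : R) : Fin 6 → R :=
  ![1,
    -1 - x * (q ^ 2 + q ^ 3 + q ^ 4),
    x * q ^ 4 * (1 - x + x * q ^ 3 + x * q ^ 4 + x * q ^ 5),
    x ^ 2 * q ^ 6 * (-1 + x * q ^ 4 * (1 + q + q ^ 2 - q ^ 5)),
    x ^ 3 * q ^ 13 * (1 + q + q ^ 2) * (1 - x * q ^ 6),
    x ^ 3 * q ^ 17 * (1 - x * q ^ 6) * (1 - x * q ^ 8)]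

/-- The polynomials `p_{2i}(x, q)`, `i = 0, …, 5`, for `𝒩₂`. -/
def p₂ {R : Type*} [CommRing R] (x q : R) : Fin 6 → R :=
  ![1,
    -1 - x * (q + q ^ 2 + q ^ 4),
    x * q ^ 4 * (1 + x * q + x * q ^ 3),
    x ^ 2 * q ^ 10 * (-1 + x * q ^ 4 + x * q ^ 6),
    x ^ 3 * q ^ 15 * (1 + q ^ 2 + q ^ 3) * (1 - x * q ^ 6),
    x ^ 3 * q ^ 19 * (1 - x * q ^ 6) * (1 - x * q ^ 8)]

/-- The polynomials `p_{2i}(x, q)`, `i = 0, …, 5`, for `𝒩₃`. -/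
def p₃ {R : Type*} [CommRing R] (x q : R) : Fin 6 → R :=
  ![1,
    -1 - x * (q ^ 2 + q ^ 4 + q ^ 5),
    x * q ^ 4 * (1 + x * q ^ 5 + x * q ^ 7),
    x ^ 2 * q ^ 10 * (-1 + x * q ^ 4 + x * q ^ 6),
    x ^ 3 * q ^ 18 * (1 + q + q ^ 3) * (1 - x * q ^ 6),
    x ^ 3 * q ^ 23 * (1 - x * q ^ 6) * (1 - x * q ^ 8)]

end Nandi

/-! Whether a part may be put in front of a partition in 𝒩 depends only on that part, the current
largest part and one of four kinds: (N1)–(N5) look back at most two parts, and for (N6) it suffices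
to know whether the differences begin with 2, …, 2, 3, 0. So 𝒩 is the language of an automaton that
reads partitions from the smallest part on (`isNandi_iff`).

The transitions use only differences and parities, hence commute with adding 2 to every part.
Cutting off the parts at most 2, which form one of five blocks, and lowering the others by 2
expresses the series of a state at x through series of states at xq² (`acc_eq_iUnion`,
`genFun_extend`). Lowering makes the remembered part zero or negative; all values at most -4 behave
alike, and a few more coincidences leave a closed linear system of seven series (`qShift_gf`).

The conditions on small parts amount to a phantom part below the partition: 𝒩₁, 𝒩₂, 𝒩₃ are the
languages of the states (-2, double), (-1, plain), (0, flagged) (`N₁_eq`, `N₂_eq`, `N₃_eq`).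
Iterating the system writes every f(xq^{2i}), i ≤ 5, in terms of the seven series at xq^{10}; the
given p_{2i} make all coefficients cancel, which is a polynomial identity. -/

namespace Nandi

/-! ### The automaton and its languages -/

/-- What the automaton remembers about the largest part read so far: it has occurred twice
(`double`), it ends a block `0, 3, 2, …, 2` of differences (`flagged`), or, otherwise, whether it
may (`free`) or may not (`plain`) be repeated. -/
inductive Kind
  | double | flagged | free | plain

/-- A state of the automaton that reads a partition from its smallest part on:
the largest part read so far, and its kind. -/
structure St where
  last : ℤ
  kind : Kind

/-- Reading the next part `a`. -/
def step (s : St) (a : ℕ) : Option St :=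
  match s.kind with
  | .double =>
    if (a : ℤ) - s.last = 3 ∧ a % 2 = 0 then some ⟨a, .flagged⟩
    else if (a : ℤ) - s.last = 4 ∧ a % 2 = 0 then some ⟨a, .free⟩
    else if 5 ≤ (a : ℤ) - s.last then some ⟨a, .free⟩
    else none
  | .flagged =>
    if (a : ℤ) - s.last = 2 then some ⟨a, .flagged⟩
    else if (a : ℤ) - s.last = 4 then some ⟨a, if a % 2 = 0 then .free else .plain⟩
    else if 5 ≤ (a : ℤ) - s.last then some ⟨a, .free⟩
    else none
  | .free =>
    if (a : ℤ) = s.last then some ⟨a, .double⟩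
    else if (a : ℤ) - s.last = 2 ∨ (a : ℤ) - s.last = 3 then some ⟨a, .plain⟩
    else if (a : ℤ) - s.last = 4 then some ⟨a, if a % 2 = 0 then .free else .plain⟩
    else if 5 ≤ (a : ℤ) - s.last then some ⟨a, .free⟩
    else none
  | .plain =>
    if (a : ℤ) - s.last = 2 ∨ (a : ℤ) - s.last = 3 then some ⟨a, .plain⟩
    else if (a : ℤ) - s.last = 4 then some ⟨a, if a % 2 = 0 then .free else .plain⟩
    else if 5 ≤ (a : ℤ) - s.last then some ⟨a, .free⟩
    else none

/-- Reading a list from its end. -/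
def run (s : Option St) (l : List ℕ) : Option St := l.foldr (fun a o => o.bind (step · a)) s

@[simp] theorem run_nil (s : Option St) : run s [] = s := rfl

theorem run_cons (s : Option St) (a : ℕ) (l : List ℕ) :
    run s (a :: l) = (run s l).bind (step · a) := rfl

theorem run_append (s : Option St) (l b : List ℕ) : run s (l ++ b) = run (run s b) l := by
  simp [run, List.foldr_append]

@[simp] theorem run_none (l : List ℕ) : run none l = none := by
  induction l with
  | nil => rfl
  | cons a l ih => simp [run_cons, ih]

theorem run_concat (s : St) (l : List ℕ) (a : ℕ) : run (some s) (l ++ [a]) = run (step s a) l := by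
  simp [run_append, run_cons]

/-- The lists of positive integers that the automaton accepts from a given state. -/
def acc (s : Option St) : Set (List ℕ) := {l | (∀ i ∈ l, 0 < i) ∧ (run s l).isSome}

@[simp] theorem acc_none : acc none = ∅ := by ext; simp [acc]

theorem nil_mem_acc (s : St) : [] ∈ acc (some s) := by simp [acc]

theorem concat_mem_acc {s : St} {l : List ℕ} {a : ℕ} :
    l ++ [a] ∈ acc (some s) ↔ 0 < a ∧ l ∈ acc (step s a) := by
  simp only [acc, Set.mem_ofPred_eq, run_concat, List.mem_append, List.mem_singleton]
  constructor
  · rintro ⟨h, h'⟩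
    exact ⟨h a (Or.inr rfl), fun i hi => h i (Or.inl hi), h'⟩
  · rintro ⟨h, h', h''⟩
    refine ⟨?_, h''⟩
    rintro i (hi | rfl)
    exacts [h' i hi, h]

/-- A state matters only through its transitions on positive parts; this is what merges states and
keeps the system finite. -/
theorem acc_eq_of_step_eq {s t : St} (h : ∀ a, 0 < a → step s a = step t a) :
    acc (some s) = acc (some t) := by
  ext l
  induction l using List.reverseRecOn with
  | nil => simp [nil_mem_acc]
  | append_singleton l a _ =>
    rw [concat_mem_acc, concat_mem_acc]
    constructor <;> rintro ⟨h0, h1⟩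
    · exact ⟨h0, h a h0 ▸ h1⟩
    · exact ⟨h0, h a h0 ▸ h1⟩

theorem step_eq_some {s t : St} {a : ℕ} (h : step s a = some t) : t.last = a ∧ s.last ≤ a := by
  obtain ⟨p, K⟩ := s
  cases K <;> simp only [step] at h <;> split_ifs at h <;> simp_all <;> subst h <;> simp <;> omega

theorem le_of_mem_of_run {s t : St} {l : List ℕ} (h : run (some s) l = some t) :
    s.last ≤ t.last ∧ ∀ i ∈ l, s.last ≤ i ∧ i ≤ t.last := by
  induction l generalizing t with
  | nil => simp_all
  | cons a l ih =>
    rw [run_cons, Option.bind_eq_some_iff] at h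
    obtain ⟨u, hu, h⟩ := h
    obtain ⟨h1, h2⟩ := step_eq_some h
    obtain ⟨h3, h4⟩ := ih hu
    refine ⟨by omega, ?_⟩
    simp only [List.mem_cons, forall_eq_or_imp]
    refine ⟨by omega, fun i hi => ?_⟩
    have := h4 i hi
    omega

theorem le_of_mem_acc {s : St} {l : List ℕ} (h : l ∈ acc (some s)) : ∀ i ∈ l, s.last ≤ i := by
  obtain ⟨t, ht⟩ := Option.isSome_iff_exists.1 h.2
  exact fun i hi => ((le_of_mem_of_run ht).2 i hi).1

theorem run_pairwise {s : St} {l : List ℕ} (h : (run (some s) l).isSome) :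
    l.Pairwise (· ≥ ·) := by
  induction l with
  | nil => simp
  | cons a l ih =>
    obtain ⟨t, ht⟩ := Option.isSome_iff_exists.1 h
    rw [run_cons, Option.bind_eq_some_iff] at ht
    obtain ⟨u, hu, ht⟩ := ht
    refine List.pairwise_cons.2 ⟨fun i hi => ?_, ih (by simp [hu])⟩
    have h1 := ((le_of_mem_of_run hu).2 i hi).2
    have h2 := step_eq_some ht
    show i ≤ a
    omega

/-! ### Cutting off the parts at most 2 -/

/-- Moving a state down by two. -/
def St.shift (s : St) : St := ⟨s.last - 2, s.kind⟩

/-- The transitions depend only on the difference to the last part and on the parity of the new one,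
and both are unchanged when everything moves by 2. -/
theorem step_add_two (s : St) (a : ℕ) :
    (step s (a + 2)).map St.shift = step s.shift a := by
  obtain ⟨p, K⟩ := s
  have h1 (d : ℤ) : (a : ℤ) + 2 - p = d ↔ (a : ℤ) - (p - 2) = d := by omega
  have h2 (d : ℤ) : d ≤ (a : ℤ) + 2 - p ↔ d ≤ (a : ℤ) - (p - 2) := by omega
  have h3 : (a : ℤ) + 2 = p ↔ (a : ℤ) = p - 2 := by omega
  cases K <;> simp only [step, St.shift, Nat.cast_add, Nat.cast_ofNat, h1, h2, h3,
    Nat.add_mod_right] <;> clear h1 h2 h3 <;> split_ifs <;> simp [St.shift, *]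

theorem run_map_add_two (s : Option St) (l : List ℕ) :
    (run s (l.map (· + 2))).map St.shift = run (s.map St.shift) l := by
  induction l with
  | nil => rfl
  | cons a l ih =>
    rw [List.map_cons, run_cons, run_cons, ← ih]
    cases run s (l.map (· + 2)) with
    | none => rfl
    | some t => exact step_add_two t a

theorem step_of_le_add_one {a c : ℕ} {K : Kind} {u : St} (h : step ⟨a, K⟩ c = some u)
    (hc : c ≤ a + 1) : a = c ∧ u = ⟨c, .double⟩ := by
  cases K <;> simp only [step] at h <;> split_ifs at h <;> first | omega | simp_all

/-- The possible sets of parts at most `2`. -/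
def blocks : Finset (List ℕ) := {[], [1], [2], [1, 1], [2, 2]}

theorem mem_blocks_of_acc {s : St} {b : List ℕ} (hb : b ∈ acc (some s))
    (h2 : ∀ i ∈ b, i ≤ 2) : b ∈ blocks := by
  induction b using List.reverseRecOn with
  | nil => simp [blocks]
  | append_singleton b a _ =>
    have ha := h2 a (by simp)
    obtain ⟨ha0, hb⟩ := concat_mem_acc.1 hb
    cases h : step s a with
    | none => simp [h] at hb
    | some t =>
    obtain ⟨h3, h4⟩ := step_eq_some h
    rw [h] at hb
    induction b using List.reverseRecOn with
    | nil => interval_cases a <;> simp [blocks]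
    | append_singleton b c _ =>
      have hc := h2 c (by simp)
      obtain ⟨hc0, hb⟩ := concat_mem_acc.1 hb
      cases h' : step t c with
      | none => simp [h'] at hb
      | some u =>
      rw [h'] at hb
      obtain ⟨p, K⟩ := t
      obtain rfl : p = a := h3
      obtain ⟨rfl, rfl⟩ := step_of_le_add_one h' (by omega)
      induction b using List.reverseRecOn with
      | nil => interval_cases a <;> simp [blocks]
      | append_singleton b d _ =>
        have hd := h2 d (by simp)
        obtain ⟨hd0, hb⟩ := concat_mem_acc.1 hb
        -- After a repeated part the next one is at least 3 larger, so a block has at most two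
        -- entries.
        have : step ⟨a, .double⟩ d = none := by
          simp only [step]
          rw [if_neg (by omega), if_neg (by omega), if_neg (by omega)]
        simp [this] at hb

/-- The lists obtained from those of `A` by adding `2` to every part and then adjoining `b`. -/
def extend (A : Set (List ℕ)) (b : List ℕ) : Set (List ℕ) :=
  (fun l => l.map (· + 2) ++ b) '' A

theorem filter_append_filter {l : List ℕ} (h : l.Pairwise (· ≥ ·)) :
    l.filter (fun i => ¬ i ≤ 2) ++ l.filter (· ≤ 2) = l := by
  induction l with
  | nil => rfl
  | cons a l ih =>
    obtain ⟨h1, h2⟩ := List.pairwise_cons.1 h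
    by_cases ha : a ≤ 2
    · have h3 : ∀ i ∈ l, i ≤ 2 := fun i hi => (h1 i hi).trans ha
      rw [List.filter_eq_nil_iff.2, List.filter_eq_self.2, List.nil_append]
      · simpa [ha] using h3
      · simpa [ha] using h3
    · simpa [List.filter_cons, ha, not_le.1 ha] using ih h2

/-- An accepted list is weakly decreasing, so its parts at most 2 are a suffix, read first; the
remaining parts are read from the state reached, and lowering them by 2 lowers that state. -/
theorem acc_eq_iUnion (s : St) :
    acc (some s) = ⋃ b ∈ blocks, extend (acc ((run (some s) b).map St.shift)) b := by
  ext l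
  simp only [Set.mem_iUnion, extend, Set.mem_image, exists_prop]
  constructor
  · intro hl
    set l' := l.filter (fun i => ¬ i ≤ 2) with hl'
    set b := l.filter (· ≤ 2) with hb
    have e : l' ++ b = l := filter_append_filter (run_pairwise hl.2)
    have e' : (l'.map (· - 2)).map (· + 2) = l' := by
      rw [List.map_map]
      conv_rhs => rw [← List.map_id l']
      refine List.map_congr_left fun i hi => ?_
      have : 2 < i := by simpa using (List.mem_filter.1 hi).2
      simp only [Function.comp, id]
      omega
    have hrun := hl.2
    rw [← e, run_append] at hrun
    have hbs : (run (some s) b).isSome := by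
      cases h : run (some s) b with
      | none => simp [h] at hrun
      | some t => rfl
    refine ⟨b, mem_blocks_of_acc ⟨fun i hi => hl.1 i (List.mem_filter.1 hi).1, hbs⟩
      fun i hi => by simpa using (List.mem_filter.1 hi).2, l'.map (· - 2), ⟨?_, ?_⟩, ?_⟩
    · intro i hi
      obtain ⟨j, hj, rfl⟩ := List.mem_map.1 hi
      have : 2 < j := by simpa using (List.mem_filter.1 hj).2
      omega
    · rw [← run_map_add_two, e']
      simpa using hrun
    · rw [e', e]
  · rintro ⟨b, hb, l', ⟨h1, h2⟩, rfl⟩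
    refine ⟨?_, ?_⟩
    · intro i hi
      rcases List.mem_append.1 hi with hi | hi
      · obtain ⟨j, hj, rfl⟩ := List.mem_map.1 hi
        omega
      · simp only [blocks, Finset.mem_insert, Finset.mem_singleton] at hb
        rcases hb with rfl | rfl | rfl | rfl | rfl <;> simp_all
    · rw [← run_map_add_two] at h2
      rw [run_append]
      simpa using h2

/-- The block can be recovered from the list as its parts at most 2. -/
theorem disjoint_extend {s t : Option St} {b c : List ℕ} (hb : b ∈ blocks) (hc : c ∈ blocks)
    (h : b ≠ c) : Disjoint (extend (acc s) b) (extend (acc t) c) := by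
  have key : ∀ {s : Option St} {b : List ℕ}, b ∈ blocks → ∀ l ∈ extend (acc s) b,
      l.filter (· ≤ 2) = b := by
    rintro s b hb _ ⟨l, hl, rfl⟩
    have h2 : ∀ i ∈ b, i ≤ 2 := by
      simp only [blocks, Finset.mem_insert, Finset.mem_singleton] at hb
      rcases hb with rfl | rfl | rfl | rfl | rfl <;> simp
    simp only [List.filter_append]
    rw [List.filter_eq_nil_iff.2, List.nil_append, List.filter_eq_self.2]
    · simpa using h2
    · intro i hi
      obtain ⟨j, hj, rfl⟩ := List.mem_map.1 hi
      have := hl.1 j hj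
      simp
      omega
  rw [Set.disjoint_left]
  intro l h1 h2
  exact h ((key hb l h1).symm.trans (key hc l h2))

/-! ### Generating functions of languages -/

theorem genFun_union {A B : Set (List ℕ)} (h : Disjoint A B) :
    genFun (A ∪ B) = genFun A + genFun B := by
  ext m n
  have e : level (A ∪ B) m n = level A m n ∪ level B m n := by
    ext l
    simp only [level, Set.mem_union, Set.mem_ofPred_eq]
    tauto
  have d : Disjoint (level A m n) (level B m n) :=
    h.mono (fun l hl => hl.1) (fun l hl => hl.1)
  simp [genFun, e, Set.ncard_union_eq d (level_finite A m n) (level_finite B m n)]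

theorem genFun_empty : genFun ∅ = 0 := by
  ext m n
  simp [genFun, level]

theorem genFun_biUnion {ι : Type*} [DecidableEq ι] (S : Finset ι) (T : ι → Set (List ℕ))
    (h : ∀ i ∈ S, ∀ j ∈ S, i ≠ j → Disjoint (T i) (T j)) :
    genFun (⋃ i ∈ S, T i) = ∑ i ∈ S, genFun (T i) := by
  induction S using Finset.induction_on with
  | empty => simp [genFun_empty]
  | insert i S hi ih =>
    rw [Finset.set_biUnion_insert, genFun_union, Finset.sum_insert hi, ih]
    · exact fun j hj k hk => h j (Finset.mem_insert_of_mem hj) k (Finset.mem_insert_of_mem hk)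
    · rw [Set.disjoint_iUnion₂_right]
      exact fun j hj => h i (Finset.mem_insert_self i S) j (Finset.mem_insert_of_mem hj)
        (fun e => hi (e ▸ hj))

theorem sum_map_add_two (l : List ℕ) : (l.map (· + 2)).sum = l.sum + 2 * l.length := by
  induction l with
  | nil => rfl
  | cons a l ih => simp only [List.map_cons, List.sum_cons, List.length_cons, ih]; ring

/-- Adding 2 to each of m parts raises the sum by 2m, which is the substitution of xq² for x; the
block contributes the monomial. -/
theorem genFun_extend (A : Set (List ℕ)) (b : List ℕ) :
    genFun (extend A b) = x ^ b.length * q ^ b.sum * qShift 2 (genFun A) := by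
  have hinj : Function.Injective (fun l : List ℕ => l.map (· + 2) ++ b) := by
    intro l l' h
    exact List.map_injective_iff.2 (fun i j h => by simpa using h) (List.append_cancel_right h)
  ext m n
  have hq : q ^ b.sum = PowerSeries.C (PowerSeries.X ^ b.sum) := by simp [q]
  rw [mul_assoc, x, PowerSeries.coeff_X_pow_mul', hq]
  split_ifs with hm
  · rw [PowerSeries.coeff_C_mul, qShift, PowerSeries.coeff_rescale, ← pow_mul, ← mul_assoc,
      ← pow_add, PowerSeries.coeff_X_pow_mul']
    simp only [genFun, PowerSeries.coeff_mk]
    split_ifs with hn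
    · congr 1
      rw [← Set.ncard_image_of_injective (level A _ _) hinj]
      congr 1
      ext l
      simp only [level, extend, Set.mem_ofPred_eq, Set.mem_image]
      constructor
      · rintro ⟨⟨l, hl, rfl⟩, h1, h2⟩
        simp only [List.length_append, List.length_map, List.sum_append, sum_map_add_two] at h1 h2
        have h3 : l.length = m - b.length := by omega
        exact ⟨l, ⟨hl, h3, by rw [← h3]; omega⟩, rfl⟩
      · rintro ⟨l, ⟨hl, h1, h2⟩, rfl⟩
        refine ⟨⟨l, hl, rfl⟩, ?_, ?_⟩
        · simp only [List.length_append, List.length_map]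
          omega
        · simp only [List.sum_append, sum_map_add_two, h1]
          omega
    · rw [Nat.cast_eq_zero, Set.ncard_eq_zero (level_finite _ _ _), Set.eq_empty_iff_forall_notMem]
      rintro _ ⟨⟨l, hl, rfl⟩, h1, h2⟩
      simp only [List.length_append, List.length_map, List.sum_append, sum_map_add_two] at h1 h2
      have h3 : l.length = m - b.length := by omega
      rw [h3] at h2
      omega
  · rw [map_zero]
    simp only [genFun, PowerSeries.coeff_mk]
    rw [Nat.cast_eq_zero, Set.ncard_eq_zero (level_finite _ _ _), Set.eq_empty_iff_forall_notMem]
    rintro _ ⟨⟨l, hl, rfl⟩, h1, h2⟩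
    simp only [List.length_append] at h1
    omega

theorem genFun_acc (s : St) :
    genFun (acc (some s)) = ∑ b ∈ blocks, x ^ b.length * q ^ b.sum *
      qShift 2 (genFun (acc ((run (some s) b).map St.shift))) := by
  rw [acc_eq_iUnion, genFun_biUnion _ _ fun b hb c hc => disjoint_extend hb hc]
  exact Finset.sum_congr rfl fun b _ => genFun_extend _ _

theorem sum_blocks {M : Type*} [AddCommMonoid M] (g : List ℕ → M) :
    ∑ b ∈ blocks, g b = g [] + g [1] + g [2] + g [1, 1] + g [2, 2] := by
  simp [blocks, add_assoc]

theorem qShift_zero_right (k : ℕ) : qShift k 0 = 0 := by simp [qShift]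

theorem qShift_add (k : ℕ) (f g : PowerSeries (PowerSeries ℤ)) :
    qShift k (f + g) = qShift k f + qShift k g := by simp [qShift]

theorem qShift_mul (k : ℕ) (f g : PowerSeries (PowerSeries ℤ)) :
    qShift k (f * g) = qShift k f * qShift k g := by simp [qShift]

theorem qShift_pow (k m : ℕ) (f : PowerSeries (PowerSeries ℤ)) :
    qShift k (f ^ m) = qShift k f ^ m := by simp [qShift]

theorem qShift_qShift (k m : ℕ) (f : PowerSeries (PowerSeries ℤ)) :
    qShift k (qShift m f) = qShift (k + m) f := by
  simp [qShift, PowerSeries.rescale_rescale, ← pow_add, add_comm]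

theorem qShift_x (k : ℕ) : qShift k x = q ^ k * x := by
  simp [qShift, x, q, PowerSeries.rescale_X]

theorem qShift_q (k : ℕ) : qShift k q = q := by
  ext m n
  rw [qShift, q, PowerSeries.coeff_rescale, PowerSeries.coeff_C]
  split_ifs with h <;> simp [h]

/-! ### The linear system for seven states -/

/-- The generating function of the lists accepted from a state. -/
noncomputable def gf (p : ℤ) (K : Kind) : PowerSeries (PowerSeries ℤ) := genFun (acc (some ⟨p, K⟩))

theorem genFun_acc_some (p : ℤ) (K : Kind) : genFun (acc (some ⟨p, K⟩)) = gf p K := rfl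

theorem gf_congr {p p' : ℤ} {K K' : Kind}
    (h : ∀ a, 0 < a → step ⟨p, K⟩ a = step ⟨p', K'⟩ a) : gf p K = gf p' K' := by
  rw [gf, gf, acc_eq_of_step_eq h]

theorem gf_eq_blocks (p : ℤ) (K : Kind) :
    gf p K = qShift 2 (gf (p - 2) K) +
      x * q * qShift 2 (genFun (acc ((run (some ⟨p, K⟩) [1]).map St.shift))) +
      x * q ^ 2 * qShift 2 (genFun (acc ((run (some ⟨p, K⟩) [2]).map St.shift))) +
      x ^ 2 * q ^ 2 * qShift 2 (genFun (acc ((run (some ⟨p, K⟩) [1, 1]).map St.shift))) +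
      x ^ 2 * q ^ 4 * qShift 2 (genFun (acc ((run (some ⟨p, K⟩) [2, 2]).map St.shift))) := by
  rw [gf, genFun_acc, sum_blocks]
  simp [St.shift, gf]

theorem gf_zero_double : gf 0 .double = qShift 2 (gf (-2) .double) := by
  refine (gf_eq_blocks _ _).trans ?_
  simp [run_cons, step, genFun_empty, qShift_zero_right]

theorem gf_free_eq_plain {p : ℤ} (hp : p ≤ 0) : gf p .free = gf p .plain :=
  gf_congr fun a ha => by
    simp only [step]
    rw [if_neg (by omega)]

theorem gf_neg_one_free : gf (-1) .free = gf (-1) .plain := gf_free_eq_plain (by norm_num)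

theorem gf_zero_free : gf 0 .free = gf 0 .plain := gf_free_eq_plain le_rfl

/-- Every positive part is at least 5 above p, so the kind no longer matters. -/
theorem step_free_of_le {p : ℤ} (hp : p ≤ -4) (K : Kind) {a : ℕ} (ha : 0 < a) :
    step ⟨p, K⟩ a = some ⟨a, .free⟩ := by
  cases K <;> simp only [step] <;> split_ifs <;> first | rfl | omega

theorem gf_of_le {p : ℤ} (hp : p ≤ -4) (K : Kind) : gf p K = gf (-4) .free :=
  gf_congr fun a ha => by rw [step_free_of_le hp K ha, step_free_of_le le_rfl .free ha]

/-- From both states 1 leads to plain, and every larger part to free. -/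
theorem gf_neg_three_plain : gf (-3) .plain = gf (-2) .plain :=
  gf_congr fun a ha => by
    simp only [step]; split_ifs <;> first | rfl | omega

/-- Both states reject 1 and 3, send 2 to flagged, and send every larger part to free. -/
theorem gf_neg_one_double : gf (-1) .double = gf 0 .flagged :=
  gf_congr fun a ha => by
    simp only [step]; split_ifs <;> first | rfl | omega

/-- Both states reject 1 and send every larger part to free. -/
theorem gf_neg_two_flagged : gf (-2) .flagged = gf (-2) .double :=
  gf_congr fun a ha => by
    simp only [step]; split_ifs <;> first | rfl | omega

theorem gf_neg_one_plain : gf (-1) .plain = qShift 2 (gf (-2) .plain) +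
    x * q * qShift 2 (gf (-1) .plain) + x * q ^ 2 * qShift 2 (gf 0 .plain) := by
  refine (gf_eq_blocks _ _).trans ?_
  simp [run_cons, step, genFun_empty, qShift_zero_right, St.shift, genFun_acc_some, gf_neg_three_plain]

theorem gf_neg_four_free : gf (-4) .free = qShift 2 (gf (-4) .free) +
    x * q * qShift 2 (gf (-1) .plain) + x * q ^ 2 * qShift 2 (gf 0 .plain) +
    x ^ 2 * q ^ 2 * qShift 2 (gf 0 .flagged) + x ^ 2 * q ^ 4 * qShift 2 (gf 0 .double) := by
  refine (gf_eq_blocks _ _).trans ?_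
  simp [run_cons, step, St.shift, genFun_acc_some,
    gf_of_le (p := -6) (by norm_num) .free, gf_neg_one_free, gf_zero_free,
    gf_neg_one_double]

theorem gf_neg_two_plain : gf (-2) .plain = qShift 2 (gf (-4) .free) +
    x * q * qShift 2 (gf (-1) .plain) + x * q ^ 2 * qShift 2 (gf 0 .plain) +
    x ^ 2 * q ^ 4 * qShift 2 (gf 0 .double) := by
  refine (gf_eq_blocks _ _).trans ?_
  simp [run_cons, step, genFun_empty, qShift_zero_right, St.shift, genFun_acc_some, gf_of_le (p := -4) le_rfl .plain,
    gf_zero_free]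

theorem gf_zero_plain : gf 0 .plain = qShift 2 (gf (-2) .plain) +
    x * q ^ 2 * qShift 2 (gf 0 .plain) := by
  refine (gf_eq_blocks _ _).trans ?_
  simp [run_cons, step, genFun_empty, qShift_zero_right, St.shift, genFun_acc_some]

theorem gf_zero_flagged : gf 0 .flagged = qShift 2 (gf (-2) .double) +
    x * q ^ 2 * qShift 2 (gf 0 .flagged) := by
  refine (gf_eq_blocks _ _).trans ?_
  simp [run_cons, step, genFun_empty, qShift_zero_right, St.shift, genFun_acc_some, gf_neg_two_flagged]

theorem gf_neg_two_double : gf (-2) .double = qShift 2 (gf (-4) .free) +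
    x * q ^ 2 * qShift 2 (gf 0 .plain) + x ^ 2 * q ^ 4 * qShift 2 (gf 0 .double) := by
  refine (gf_eq_blocks _ _).trans ?_
  simp [run_cons, step, genFun_empty, qShift_zero_right, St.shift, genFun_acc_some,
    gf_of_le (p := -4) le_rfl .double, gf_zero_free]

/-- The whole system with x replaced by xq^k. For a fixed k, rewriting with the conjunction moves
all seven series from level k to level k + 2 and then stops. -/
theorem qShift_gf (k : ℕ) :
    qShift k (gf 0 .double) = qShift (k + 2) (gf (-2) .double) ∧
    qShift k (gf (-1) .plain) = qShift (k + 2) (gf (-2) .plain) +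
      q ^ k * x * q * qShift (k + 2) (gf (-1) .plain) +
      q ^ k * x * q ^ 2 * qShift (k + 2) (gf 0 .plain) ∧
    qShift k (gf (-4) .free) = qShift (k + 2) (gf (-4) .free) +
      q ^ k * x * q * qShift (k + 2) (gf (-1) .plain) +
      q ^ k * x * q ^ 2 * qShift (k + 2) (gf 0 .plain) +
      (q ^ k * x) ^ 2 * q ^ 2 * qShift (k + 2) (gf 0 .flagged) +
      (q ^ k * x) ^ 2 * q ^ 4 * qShift (k + 2) (gf 0 .double) ∧
    qShift k (gf (-2) .plain) = qShift (k + 2) (gf (-4) .free) +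
      q ^ k * x * q * qShift (k + 2) (gf (-1) .plain) +
      q ^ k * x * q ^ 2 * qShift (k + 2) (gf 0 .plain) +
      (q ^ k * x) ^ 2 * q ^ 4 * qShift (k + 2) (gf 0 .double) ∧
    qShift k (gf 0 .plain) = qShift (k + 2) (gf (-2) .plain) +
      q ^ k * x * q ^ 2 * qShift (k + 2) (gf 0 .plain) ∧
    qShift k (gf 0 .flagged) = qShift (k + 2) (gf (-2) .double) +
      q ^ k * x * q ^ 2 * qShift (k + 2) (gf 0 .flagged) ∧
    qShift k (gf (-2) .double) = qShift (k + 2) (gf (-4) .free) +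
      q ^ k * x * q ^ 2 * qShift (k + 2) (gf 0 .plain) +
      (q ^ k * x) ^ 2 * q ^ 4 * qShift (k + 2) (gf 0 .double) := by
  have e0 := congrArg (qShift k) gf_zero_double
  have e1 := congrArg (qShift k) gf_neg_one_plain
  have e2 := congrArg (qShift k) gf_neg_four_free
  have e3 := congrArg (qShift k) gf_neg_two_plain
  have e4 := congrArg (qShift k) gf_zero_plain
  have e5 := congrArg (qShift k) gf_zero_flagged
  have e6 := congrArg (qShift k) gf_neg_two_double
  simp only [qShift_add, qShift_mul, qShift_pow, qShift_x, qShift_q, qShift_qShift]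
    at e0 e1 e2 e3 e4 e5 e6
  exact ⟨e0, e1, e2, e3, e4, e5, e6⟩

/-! ### Elimination -/

theorem functional_equation_neg_two_double :
    0 = ∑ i : Fin 6, p₁ x q i * qShift (2 * (i : ℕ)) (gf (-2) .double) := by
  simp only [Fin.sum_univ_six, p₁, Matrix.cons_val, Fin.coe_ofNat_eq_mod, Nat.reduceMod,
    Nat.reduceMul]
  -- Five rewrites bring every term to level 10, where the shifted series serve as independent atoms
  -- for `ring`.
  simp only [qShift_gf 0, Nat.reduceAdd]
  simp only [qShift_gf 2, Nat.reduceAdd]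
  simp only [qShift_gf 4, Nat.reduceAdd]
  simp only [qShift_gf 6, Nat.reduceAdd]
  simp only [qShift_gf 8, Nat.reduceAdd]
  ring

theorem functional_equation_neg_one_plain :
    0 = ∑ i : Fin 6, p₂ x q i * qShift (2 * (i : ℕ)) (gf (-1) .plain) := by
  simp only [Fin.sum_univ_six, p₂, Matrix.cons_val, Fin.coe_ofNat_eq_mod, Nat.reduceMod,
    Nat.reduceMul]
  simp only [qShift_gf 0, Nat.reduceAdd]
  simp only [qShift_gf 2, Nat.reduceAdd]
  simp only [qShift_gf 4, Nat.reduceAdd]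
  simp only [qShift_gf 6, Nat.reduceAdd]
  simp only [qShift_gf 8, Nat.reduceAdd]
  ring

theorem functional_equation_zero_flagged :
    0 = ∑ i : Fin 6, p₃ x q i * qShift (2 * (i : ℕ)) (gf 0 .flagged) := by
  simp only [Fin.sum_univ_six, p₃, Matrix.cons_val, Fin.coe_ofNat_eq_mod, Nat.reduceMod,
    Nat.reduceMul]
  simp only [qShift_gf 0, Nat.reduceAdd]
  simp only [qShift_gf 2, Nat.reduceAdd]
  simp only [qShift_gf 4, Nat.reduceAdd]
  simp only [qShift_gf 6, Nat.reduceAdd]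
  simp only [qShift_gf 8, Nat.reduceAdd]
  ring

/-! ### The automaton recognises 𝒩 -/

theorem diffs_cons_cons (a b : ℕ) (r : List ℕ) : diffs (a :: b :: r) = (a - b) :: diffs (b :: r) :=
  rfl

/-- The differences begin with a block `2, …, 2, 3, 0`. -/
def StartsFlagged (l : List ℕ) : Prop := ∃ k : ℕ, (List.replicate k 2 ++ [3, 0]) <+: diffs l

theorem startsFlagged_pair (a b : ℕ) : ¬ StartsFlagged [a, b] := by
  rintro ⟨k, hk⟩
  have := hk.length_le
  simp [diffs] at this

/-- The alternatives are k > 0 and k = 0; they mirror the two ways into a flagged state, from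
flagged by a difference 2 and from double by a difference 3. -/
theorem startsFlagged_cons (a b c : ℕ) (r : List ℕ) : StartsFlagged (a :: b :: c :: r) ↔
    (a - b = 2 ∧ StartsFlagged (b :: c :: r)) ∨ (a - b = 3 ∧ b - c = 0) := by
  rw [StartsFlagged, diffs_cons_cons]
  constructor
  · rintro ⟨_ | k, hk⟩
    · rw [diffs_cons_cons] at hk
      simp only [List.replicate_zero, List.nil_append, List.cons_prefix_cons] at hk
      exact Or.inr ⟨hk.1.symm, hk.2.1.symm⟩
    · rw [List.replicate_succ, List.cons_append, List.cons_prefix_cons] at hk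
      exact Or.inl ⟨hk.1.symm, k, hk.2⟩
  · rintro (⟨h, k, hk⟩ | ⟨h, h'⟩)
    · refine ⟨k + 1, ?_⟩
      rw [List.replicate_succ, List.cons_append, List.cons_prefix_cons]
      exact ⟨h.symm, hk⟩
    · refine ⟨0, ?_⟩
      rw [diffs_cons_cons, h, h']
      simp [List.cons_prefix_cons]

theorem par_cons_cons {a b : ℕ} {r : List ℕ} :
    a :: b :: r ∈ Par ↔ b :: r ∈ Par ∧ b ≤ a ∧ 0 < a := by
  simp only [Par, Set.mem_ofPred_eq, List.pairwise_cons, List.mem_cons, forall_eq_or_imp]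
  constructor
  · rintro ⟨⟨⟨h1, h2⟩, h3⟩, h4, h5⟩
    exact ⟨⟨h3, h5⟩, h1, h4⟩
  · rintro ⟨⟨h3, h5⟩, h1, h4⟩
    exact ⟨⟨⟨h1, fun i hi => (h3.1 i hi).trans h1⟩, h3⟩, h4, h5⟩

theorem isNandi_nil : IsNandi [] := by
  constructor <;> simp [Par, diffs]

theorem isNandi_singleton {a : ℕ} (ha : 0 < a) : IsNandi [a] := by
  constructor <;> simp [Par, diffs, ha]

theorem isNandi_pair {a b : ℕ} :
    IsNandi [a, b] ↔ 0 < b ∧ b ≤ a ∧ a - b ≠ 1 := by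
  constructor
  · intro h
    have h1 := par_cons_cons.1 h.mem_par
    exact ⟨h1.1.2 b (by simp), h1.2.1, h.cond1 0 (by simp)⟩
  · rintro ⟨h1, h2, h3⟩
    refine ⟨par_cons_cons.2 ⟨(isNandi_singleton h1).mem_par, h2, by omega⟩, ?_, ?_, ?_, ?_, ?_, ?_⟩
    · rintro (_ | i) hi
      · exact h3
      · simp at hi
    · intro i hi; simp at hi
    · intro i hi; simp at hi
    · intro i hi; simp at hi
    · intro i hi; simp at hi
    · intro k hk
      have := hk.length_le
      simp [diffs] at this

/-- Only the windows at the front are new; for (N6) a new occurrence must start with the first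
difference. -/
theorem isNandi_cons {a b c : ℕ} {r : List ℕ} :
    IsNandi (a :: b :: c :: r) ↔ IsNandi (b :: c :: r) ∧ b ≤ a ∧ a - b ≠ 1 ∧ 3 ≤ a - c ∧
      (a - c = 3 → a ≠ b) ∧ (a - c = 3 → ¬ 2 ∣ a → b ≠ c) ∧
      (a - c = 4 → ¬ 2 ∣ a → a ≠ b ∧ b ≠ c) ∧ (a - b = 3 → ¬ StartsFlagged (b :: c :: r)) := by
  constructor
  · intro h
    have h1 := par_cons_cons.1 h.mem_par
    refine ⟨⟨h1.1, fun i hi => ?_, fun i hi => ?_, fun i hi => ?_, fun i hi => ?_, fun i hi => ?_,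
      fun k hk => ?_⟩, h1.2.1, h.cond1 0 (by simp), h.cond2 0 (by simp), h.cond3 0 (by simp),
      h.cond4 0 (by simp), h.cond5 0 (by simp), ?_⟩
    · exact h.cond1 (i + 1) (by simpa using hi)
    · exact h.cond2 (i + 1) (by simpa using hi)
    · exact h.cond3 (i + 1) (by simpa using hi)
    · exact h.cond4 (i + 1) (by simpa using hi)
    · exact h.cond5 (i + 1) (by simpa using hi)
    · exact h.cond6 k (List.infix_cons_iff.2 (Or.inr hk))
    · rintro h3 ⟨k, hk⟩
      refine h.cond6 k (List.IsPrefix.isInfix ?_)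
      rw [diffs_cons_cons, h3, List.append_assoc, List.singleton_append, List.cons_prefix_cons]
      exact ⟨rfl, hk⟩
  · rintro ⟨h, h0, h1, h2, h3, h4, h5, h6⟩
    refine ⟨par_cons_cons.2 ⟨h.mem_par, h0, ?_⟩, ?_, ?_, ?_, ?_, ?_, ?_⟩
    · have := h.mem_par.2 b (by simp)
      omega
    · rintro (_ | i) hi
      exacts [h1, h.cond1 i (by simpa using hi)]
    · rintro (_ | i) hi
      exacts [h2, h.cond2 i (by simpa using hi)]
    · rintro (_ | i) hi
      exacts [h3, h.cond3 i (by simpa using hi)]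
    · rintro (_ | i) hi
      exacts [h4, h.cond4 i (by simpa using hi)]
    · rintro (_ | i) hi
      exacts [h5, h.cond5 i (by simpa using hi)]
    · intro k hk
      rw [diffs_cons_cons, List.infix_cons_iff] at hk
      rcases hk with hk | hk
      · rw [List.append_assoc, List.singleton_append, List.cons_prefix_cons] at hk
        exact h6 hk.1.symm ⟨k, hk.2⟩
      · exact h.cond6 k hk

/-- The initial state. -/
abbrev St.init : St := ⟨-4, .free⟩

open Classical in
/-- The state of the automaton after reading an element of `𝒩`. -/
noncomputable def stateOf : List ℕ → St
  | [] => St.init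
  | [a] => ⟨a, .free⟩
  | a :: b :: r => ⟨a, if a = b then .double else if StartsFlagged (a :: b :: r) then .flagged
      else if 5 ≤ a - b ∨ (a - b = 4 ∧ a % 2 = 0) then .free else .plain⟩

theorem step_natCast (b : ℕ) (K : Kind) (a : ℕ) : step ⟨b, K⟩ a =
    match K with
    | .double =>
      if a = b + 3 ∧ a % 2 = 0 then some ⟨a, .flagged⟩
      else if a = b + 4 ∧ a % 2 = 0 then some ⟨a, .free⟩
      else if b + 5 ≤ a then some ⟨a, .free⟩
      else none
    | .flagged =>
      if a = b + 2 then some ⟨a, .flagged⟩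
      else if a = b + 4 then some ⟨a, if a % 2 = 0 then .free else .plain⟩
      else if b + 5 ≤ a then some ⟨a, .free⟩
      else none
    | .free =>
      if a = b then some ⟨a, .double⟩
      else if a = b + 2 ∨ a = b + 3 then some ⟨a, .plain⟩
      else if a = b + 4 then some ⟨a, if a % 2 = 0 then .free else .plain⟩
      else if b + 5 ≤ a then some ⟨a, .free⟩
      else none
    | .plain =>
      if a = b + 2 ∨ a = b + 3 then some ⟨a, .plain⟩
      else if a = b + 4 then some ⟨a, if a % 2 = 0 then .free else .plain⟩
      else if b + 5 ≤ a then some ⟨a, .free⟩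
      else none := by
  have h2 : (a : ℤ) - b = 2 ↔ a = b + 2 := by omega
  have h3 : (a : ℤ) - b = 3 ↔ a = b + 3 := by omega
  have h4 : (a : ℤ) - b = 4 ↔ a = b + 4 := by omega
  have h5 : 5 ≤ (a : ℤ) - b ↔ b + 5 ≤ a := by omega
  cases K <;> simp only [step, h2, h3, h4, h5, Nat.cast_inj]

theorem step_stateOf_pair {a b : ℕ} (hb : 0 < b) :
    (IsNandi [a, b] → step (stateOf [b]) a = some (stateOf [a, b])) ∧
    (¬ IsNandi [a, b] → step (stateOf [b]) a = none) := by
  rw [isNandi_pair]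
  simp only [stateOf, startsFlagged_pair, step_natCast, if_false]
  refine ⟨fun h => ?_, fun h => ?_⟩ <;> split_ifs <;> first | rfl | omega

-- The kind records what the new conditions need. A part can be repeated only if the difference
-- before it is at least 5, or is 4 with the part even, by (N2), (N3), (N5); after a repeated part,
-- a difference 3 or 4 needs an even new part by (N4), (N5); flagged forbids a difference 3 by (N6).
set_option maxHeartbeats 1000000 in
theorem step_stateOf_cons {a b c : ℕ} {r : List ℕ} (h : IsNandi (b :: c :: r)) :
    (IsNandi (a :: b :: c :: r) →
      step (stateOf (b :: c :: r)) a = some (stateOf (a :: b :: c :: r))) ∧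
    (¬ IsNandi (a :: b :: c :: r) → step (stateOf (b :: c :: r)) a = none) := by
  have hcb := (par_cons_cons.1 h.mem_par).2.1
  have h1 := h.cond1 0 (by simp)
  -- A block 2, …, 2, 3, 0 begins with 2 or 3, so flagged excludes both double and free.
  have hU : StartsFlagged (b :: c :: r) → b - c = 2 ∨ b - c = 3 := by
    rcases r with _ | ⟨d, r⟩
    · exact fun h => absurd h (startsFlagged_pair b c)
    · rw [startsFlagged_cons]
      tauto
  have hF := startsFlagged_cons a b c r
  rw [isNandi_cons]
  simp only [h, true_and, stateOf, step_natCast]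
  simp only [List.getElem_cons_zero, zero_add, List.getElem_cons_succ] at h1
  by_cases hv : StartsFlagged (a :: b :: c :: r) <;> by_cases hu : StartsFlagged (b :: c :: r) <;>
    simp only [hv, hu, true_iff, false_iff, and_true, and_false, false_or, not_true_eq_false,
      not_false_eq_true, implies_true, imp_false, forall_const, if_true, if_false] at hF hU ⊢ <;>
    by_cases hbc : b = c <;> (try simp only [hbc, if_true, if_false]) <;>
    by_cases hf : 5 ≤ b - c ∨ (b - c = 4 ∧ b % 2 = 0) <;>
    first
      | (exfalso; omega)
      | (try simp only [hf, if_true, if_false]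
         refine ⟨fun h => ?_, fun h => ?_⟩ <;> split_ifs <;> first | rfl | omega)

theorem IsNandi.tail {a : ℕ} {l : List ℕ} (h : IsNandi (a :: l)) : IsNandi l := by
  rcases l with _ | ⟨b, _ | ⟨c, r⟩⟩
  · exact isNandi_nil
  · exact isNandi_singleton (isNandi_pair.1 h).1
  · exact (isNandi_cons.1 h).1

theorem run_init {l : List ℕ} (hl : ∀ i ∈ l, 0 < i) :
    (IsNandi l → run (some St.init) l = some (stateOf l)) ∧
    (¬ IsNandi l → run (some St.init) l = none) := by
  induction l with
  | nil => simp [isNandi_nil, stateOf]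
  | cons a l ih =>
    have ih := ih fun i hi => hl i (List.mem_cons_of_mem a hi)
    have ha := hl a List.mem_cons_self
    rw [run_cons]
    by_cases h : IsNandi l
    · rw [ih.1 h, Option.bind_some]
      rcases l with _ | ⟨b, _ | ⟨c, r⟩⟩
      · simp [isNandi_singleton ha, stateOf, step_free_of_le le_rfl .free ha]
      · exact step_stateOf_pair (hl b (by simp))
      · exact step_stateOf_cons h
    · rw [ih.2 h, Option.bind_none]
      exact ⟨fun h' => absurd h'.tail h, fun _ => rfl⟩

theorem isNandi_iff {l : List ℕ} : IsNandi l ↔ l ∈ acc (some St.init) := by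
  constructor
  · intro h
    exact ⟨h.mem_par.2, by simp [(run_init h.mem_par.2).1 h]⟩
  · rintro ⟨h, h'⟩
    by_contra hn
    simp [(run_init h).2 hn] at h'

/-! ### 𝒩₁, 𝒩₂, 𝒩₃ as languages of states -/

theorem step_init {a : ℕ} (ha : 0 < a) : step St.init a = some ⟨a, .free⟩ :=
  step_free_of_le le_rfl .free ha

theorem count_eq_zero_of_acc {s : St} {l : List ℕ} (h : l ∈ acc (some s)) {i : ℕ}
    (hi : i < s.last) : l.count i = 0 :=
  List.count_eq_zero.2 fun hm => absurd (le_of_mem_acc h i hm) (by omega)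

/-- Above a doubled phantom part -2, the part 1 has the odd-part difference 3 and is rejected, while
every larger first part becomes free, as from the initial state. -/
theorem N₁_eq : N₁ = acc (some ⟨-2, .double⟩) := by
  have h1 : step ⟨-2, .double⟩ 1 = none := by simp [step]
  have h2 {a : ℕ} (ha : 2 ≤ a) : step ⟨-2, .double⟩ a = some ⟨a, .free⟩ := by
    simp only [step]; split_ifs <;> first | rfl | omega
  ext l
  simp only [N₁, Set.mem_ofPred_eq, isNandi_iff]
  induction l using List.reverseRecOn with
  | nil => simp [nil_mem_acc]
  | append_singleton l a _ =>
    rw [concat_mem_acc, concat_mem_acc]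
    rcases (by omega : a = 0 ∨ a = 1 ∨ 2 ≤ a) with rfl | rfl | ha
    · simp
    · simp [h1]
    · rw [h2 ha, step_init (by omega)]
      refine ⟨fun h => h.1, fun h => ⟨h, ?_⟩⟩
      have := count_eq_zero_of_acc h.2 (i := 1) (by simp; omega)
      rw [List.count_append, this, List.count_singleton, if_neg (by simp; omega)]

theorem acc_plain_subset {p : ℤ} : acc (some ⟨p, .plain⟩) ⊆ acc (some ⟨p, .free⟩) := by
  intro l h
  induction l using List.reverseRecOn with
  | nil => exact nil_mem_acc _
  | append_singleton l a _ =>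
    rw [concat_mem_acc] at h ⊢
    by_cases ha : (a : ℤ) = p
    · have : step ⟨p, .plain⟩ a = none := by
        simp only [step]; split_ifs <;> first | rfl | omega
      simp [this] at h
    · have : step ⟨p, .free⟩ a = step ⟨p, .plain⟩ a := by
        simp [step, ha]
      rwa [this]

/-- The states differ only in the transition on p itself. -/
theorem mem_acc_plain_of_count {p : ℕ} {l : List ℕ} (h : l ∈ acc (some ⟨p, .free⟩))
    (hl : l.count p = 0) : l ∈ acc (some ⟨p, .plain⟩) := by
  induction l using List.reverseRecOn with
  | nil => exact nil_mem_acc _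
  | append_singleton l a _ =>
    rw [concat_mem_acc] at h ⊢
    have ha : a ≠ p := by
      rintro rfl
      simp at hl
    have : step ⟨p, .free⟩ a = step ⟨p, .plain⟩ a := by
      simp [step, ha]
    rwa [← this]

theorem concat_mem_acc_imp {s : St} {l : List ℕ} {a : ℕ} (h : l ++ [a] ∈ acc (some s)) :
    ∃ K, step s a = some ⟨a, K⟩ ∧ l ∈ acc (some ⟨a, K⟩) := by
  obtain ⟨h0, h⟩ := concat_mem_acc.1 h
  cases hs : step s a with
  | none => simp [hs] at h
  | some t =>
    obtain ⟨p, K⟩ := t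
    obtain rfl : p = a := (step_eq_some hs).1
    exact ⟨K, rfl, hs ▸ h⟩

theorem count_of_acc_plain {p : ℕ} {l : List ℕ} (h : l ∈ acc (some ⟨p, .plain⟩)) :
    l.count p = 0 ∧ l.count (p + 1) = 0 := by
  induction l using List.reverseRecOn with
  | nil => simp
  | append_singleton l a _ =>
    obtain ⟨K, hs, h⟩ := concat_mem_acc_imp h
    have ha : p + 2 ≤ a := by
      simp only [step] at hs
      split_ifs at hs <;> omega
    simp only [List.count_append, List.count_singleton]
    rw [count_eq_zero_of_acc h (by simp; omega), count_eq_zero_of_acc h (by simp; omega),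
      if_neg (by simp; omega), if_neg (by simp; omega)]
    simp

/-- Above a phantom part -1, the parts 1, 2, 3 have differences 2, 3, 4, the last with an odd part,
so each becomes plain and cannot be repeated; from 4 on the first part is free. -/
theorem N₂_eq : N₂ = acc (some ⟨-1, .plain⟩) := by
  have h1 {a : ℕ} (h0 : 0 < a) (ha : a ≤ 3) : step ⟨-1, .plain⟩ a = some ⟨a, .plain⟩ := by
    interval_cases a <;> simp [step]
  have h2 {a : ℕ} (ha : 4 ≤ a) : step ⟨-1, .plain⟩ a = some ⟨a, .free⟩ := by
    simp only [step]; split_ifs <;> first | rfl | omega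
  ext l
  simp only [N₂, Set.mem_ofPred_eq, isNandi_iff]
  induction l using List.reverseRecOn with
  | nil => simp [nil_mem_acc]
  | append_singleton l a _ =>
    rw [concat_mem_acc, concat_mem_acc]
    rcases (by omega : a = 0 ∨ 0 < a) with rfl | h0
    · simp
    rw [step_init h0]
    rcases Nat.lt_or_ge a 4 with ha | ha
    · rw [h1 h0 (by omega)]
      constructor
      · rintro ⟨⟨-, h⟩, hc⟩
        refine ⟨h0, mem_acc_plain_of_count h ?_⟩
        simp only [List.count_append, List.count_singleton] at hc
        interval_cases a <;> simp at hc <;> tauto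
      · rintro ⟨-, h⟩
        refine ⟨⟨h0, acc_plain_subset h⟩, ?_⟩
        obtain ⟨c1, c2⟩ := count_of_acc_plain h
        have c3 (i : ℕ) (hi : i < a) := count_eq_zero_of_acc h (i := i) (by simpa using hi)
        simp only [List.count_append, List.count_singleton]
        interval_cases a
        -- After 1, `count_of_acc_plain` excludes only another 1 and a 2. A following 3 has
        -- difference 2, hence is plain and occurs once.
        · have c4 : l.count 3 ≤ 1 := by
            induction l using List.reverseRecOn with
            | nil => simp
            | append_singleton l b _ =>
              obtain ⟨K, hs, h⟩ := concat_mem_acc_imp h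
              simp only [List.count_append, List.count_singleton]
              rcases (by omega : b ≤ 2 ∨ b = 3 ∨ 4 ≤ b) with hb | rfl | hb
              · interval_cases b <;> simp [step] at hs
              · obtain rfl : K = .plain := by simpa [step, eq_comm] using hs
                simp [(count_of_acc_plain h).1]
              · rw [count_eq_zero_of_acc h (by simp; omega), if_neg (by simp; omega)]
                simp
          simp_all
        · simp_all
        · simp_all
    · rw [h2 ha]
      refine ⟨fun h => h.1, fun h => ⟨h, ?_⟩⟩
      have c3 (i : ℕ) (hi : i < a) := count_eq_zero_of_acc h.2 (i := i) (by simpa using hi)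
      simp only [List.count_append, List.count_singleton]
      rw [c3 1 (by omega), c3 2 (by omega), c3 3 (by omega), if_neg (by simp; omega),
        if_neg (by simp; omega), if_neg (by simp; omega)]
      simp

/-- The sequence `(2k, 2k - 2, …, 4, 2)`. -/
def evens (k : ℕ) : List ℕ := (List.range k).map (fun j => 2 * (k - j))

theorem staircase_eq (k : ℕ) : staircase k = (2 * k + 3) :: evens k := rfl

theorem evens_succ (k : ℕ) : evens (k + 1) = (2 * (k + 1)) :: evens k := by
  simp [evens, List.range_succ_eq_map, Function.comp_def]

theorem exists_evens_eq_concat {k : ℕ} (hk : 1 ≤ k) : ∃ w, evens k = w ++ [2] := by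
  obtain ⟨k, rfl⟩ := Nat.exists_eq_add_of_le' hk
  exact ⟨(List.range k).map (fun j => 2 * (k + 1 - j)), by simp [evens, List.range_succ]⟩

theorem run_evens (k : ℕ) :
    run (some ⟨0, .flagged⟩) (evens k) = some ⟨(2 * k : ℕ), .flagged⟩ := by
  induction k with
  | zero => rfl
  | succ k ih =>
    rw [evens_succ, run_cons, ih, Option.bind_some, step_natCast]
    simp only
    rw [if_pos (by ring)]

/-- Flagged has the transitions of plain without the difference 3, and a difference 2 keeps each
kind. -/
theorem acc_flagged_subset {p : ℤ} : acc (some ⟨p, .flagged⟩) ⊆ acc (some ⟨p, .plain⟩) := by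
  intro l h
  induction l using List.reverseRecOn generalizing p with
  | nil => exact nil_mem_acc _
  | append_singleton l a ih =>
    rw [concat_mem_acc] at h ⊢
    refine ⟨h.1, ?_⟩
    have h := h.2
    by_cases h2 : (a : ℤ) - p = 2
    · simp only [step, h2, if_true] at h
      simpa only [step, h2, true_or, if_true] using ih h
    · by_cases h3 : (a : ℤ) - p = 3
      · simp [step, h3] at h
      · simpa [step, h2, h3] using h

/-- As long as 2k + 2, 2k + 4, … are read, plain and flagged run in parallel; they part only on a
difference 3, which would complete a staircase. The parts already read are kept in the hypothesis as
`evens k`. -/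
theorem mem_acc_flagged {k : ℕ} (hk : 1 ≤ k) {l : List ℕ} (h : l ∈ acc (some ⟨(2 * k : ℕ), .plain⟩))
    (hs : ∀ j, 1 ≤ j → ¬ staircase j <:+: l ++ evens k) :
    l ∈ acc (some ⟨(2 * k : ℕ), .flagged⟩) := by
  induction l using List.reverseRecOn generalizing k with
  | nil => exact nil_mem_acc _
  | append_singleton l a ih =>
    rw [concat_mem_acc, step_natCast] at h ⊢
    refine ⟨h.1, ?_⟩
    have h := h.2
    simp only at h ⊢
    by_cases h2 : a = 2 * k + 2
    · rw [if_pos (Or.inl h2)] at h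
      rw [if_pos h2]
      obtain rfl : a = 2 * (k + 1) := h2
      refine ih (k := k + 1) (by omega) h ?_
      simpa [evens_succ] using hs
    · have h3 : a ≠ 2 * k + 3 := by
        rintro rfl
        exact hs k hk ⟨l, [], by simp [staircase_eq]⟩
      simpa [h2, h3] using h

/-- A staircase ends in 2, and this state admits neither 1 nor a second 2, so the staircase would
have to end the list. Reading its even parts then keeps the state flagged, and 2k + 3 is rejected.
-/
theorem not_staircase_infix {l : List ℕ} (h : l ∈ acc (some ⟨0, .flagged⟩)) {k : ℕ} (hk : 1 ≤ k) :
    ¬ staircase k <:+: l := by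
  rintro ⟨u, v, rfl⟩
  have hr := h.2
  rw [run_append] at hr
  have hv0 : ∀ i ∈ v, 0 < i := fun i hi => h.1 i (by simp [hi])
  obtain ⟨w, hw⟩ := exists_evens_eq_concat hk
  cases ht : run (some ⟨0, .flagged⟩) v with
  | none => simp [ht] at hr
  | some t =>
  rw [ht] at hr
  induction v using List.reverseRecOn with
  | nil =>
    obtain rfl : (⟨0, .flagged⟩ : St) = t := by simpa using ht
    rw [run_append, staircase_eq, run_cons, run_evens, Option.bind_some, step_natCast] at hr
    simp at hr
  | append_singleton v a _ =>
    obtain ⟨t', ht'⟩ := Option.isSome_iff_exists.1 hr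
    -- Lists are read from the right, so all of v precedes the final 2 of the staircase and has
    -- parts at most 2.
    have ht2 : t.last ≤ 2 := ((le_of_mem_of_run ht').2 2 (by simp [staircase_eq, hw])).1
    have hle := (le_of_mem_of_run ht).2
    have hv : v ++ [a] ∈ acc (some ⟨0, .flagged⟩) := ⟨hv0, by simp [ht]⟩
    have ha := hle a (by simp)
    have ha0 := hv0 a (by simp)
    obtain ⟨K, hs, hv⟩ := concat_mem_acc_imp hv
    obtain rfl : a = 2 := by
      rcases (by omega : a = 1 ∨ a = 2) with rfl | rfl
      · simp [step] at hs
      · rfl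
    obtain rfl : K = .flagged := by simpa [step, eq_comm] using hs
    induction v using List.reverseRecOn with
    | nil =>
      obtain rfl : (⟨2, .flagged⟩ : St) = t := by simpa [run_cons, step] using ht
      rw [staircase_eq, hw, ← List.cons_append, ← List.append_assoc, run_concat] at hr
      simp [step] at hr
    | append_singleton v c _ =>
      have hc := (hle c (by simp)).2
      obtain ⟨K, hs, -⟩ := concat_mem_acc_imp hv
      have : c ≤ 2 := by omega
      interval_cases c <;> simp [step] at hs

/-- The phantom part 0 acts as the end of a block 0, 3: it rejects 1 and 3, makes 2 unrepeatable,
and turns (N6) into the exclusion of staircases. -/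
theorem N₃_eq : N₃ = acc (some ⟨0, .flagged⟩) := by
  have h1 : step ⟨0, .flagged⟩ 1 = none := by simp [step]
  have h2 : step ⟨0, .flagged⟩ 2 = some ⟨2, .flagged⟩ := by simp [step]
  have h3 : step ⟨0, .flagged⟩ 3 = none := by simp [step]
  have h4 {a : ℕ} (ha : 4 ≤ a) : step ⟨0, .flagged⟩ a = some ⟨a, .free⟩ := by
    simp only [step]; split_ifs <;> first | rfl | omega
  ext l
  simp only [N₃, Set.mem_ofPred_eq, isNandi_iff]
  constructor
  · rintro ⟨h, c1, c3, c2, hs⟩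
    induction l using List.reverseRecOn with
    | nil => exact nil_mem_acc _
    | append_singleton l a _ =>
      rw [concat_mem_acc] at h ⊢
      obtain ⟨h0, h⟩ := h
      rw [step_init h0] at h
      refine ⟨h0, ?_⟩
      rcases (by omega : a = 1 ∨ a = 2 ∨ a = 3 ∨ 4 ≤ a) with rfl | rfl | rfl | ha
      · simp at c1
      · rw [h2]
        refine mem_acc_flagged le_rfl (mem_acc_plain_of_count h ?_) hs
        simpa using c2
      · simp at c3
      · rwa [h4 ha]
  · intro h
    have hs := fun k hk => not_staircase_infix h (k := k) hk
    induction l using List.reverseRecOn with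
    | nil => exact ⟨nil_mem_acc _, by simp, by simp, by simp, hs⟩
    | append_singleton l a _ =>
      rw [concat_mem_acc] at h ⊢
      obtain ⟨h0, h⟩ := h
      rw [step_init h0]
      rcases (by omega : a = 1 ∨ a = 2 ∨ a = 3 ∨ 4 ≤ a) with rfl | rfl | rfl | ha
      · simp [h1] at h
      · rw [h2] at h
        have h := acc_flagged_subset h
        have c := count_of_acc_plain (p := 2) h
        have c1 := count_eq_zero_of_acc h (i := 1) (by simp)
        refine ⟨⟨h0, acc_plain_subset h⟩, ?_, ?_, ?_, hs⟩ <;> simp_all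
      · simp [h3] at h
      · rw [h4 ha] at h
        have c (i : ℕ) (hi : i < 4) : (l ++ [a]).count i = 0 := by
          rw [List.count_append, count_eq_zero_of_acc h (by simp; omega), List.count_singleton,
            if_neg (by simp; omega)]
        exact ⟨⟨h0, h⟩, c 1 (by omega), c 3 (by omega), (c 2 (by omega)).le.trans zero_le_one, hs⟩

end Nandi

theorem proposition4p1 :
    (0 = ∑ i : Fin 6, Nandi.p₁ Nandi.x Nandi.q i *
      Nandi.qShift (2 * (i : ℕ)) (Nandi.genFun Nandi.N₁)) ∧
    (0 = ∑ i : Fin 6, Nandi.p₂ Nandi.x Nandi.q i *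
      Nandi.qShift (2 * (i : ℕ)) (Nandi.genFun Nandi.N₂)) ∧
    (0 = ∑ i : Fin 6, Nandi.p₃ Nandi.x Nandi.q i *
      Nandi.qShift (2 * (i : ℕ)) (Nandi.genFun Nandi.N₃)) := by
  rw [Nandi.N₁_eq, Nandi.N₂_eq, Nandi.N₃_eq]
  exact ⟨Nandi.functional_equation_neg_two_double, Nandi.functional_equation_neg_one_plain,
    Nandi.functional_equation_zero_flagged⟩
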